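/- Let $K$ be a field and $A$ a finite-dimensional $K$-algebra; modules are finite-dimensional right $A$-modules and $D=\operatorname{Hom}_K(-,K)$. The dominant dimension $\operatorname{domdim}(M)\in\mathbb N\cup\{\infty\}$ of a module $M$ with minimal injective resolution $0\to M\to I_0\to I_1\to\cdots$ is the supremum of all $n\ge 0$ such that $I_0,\dots,I_{n-1}$ are projective, and $\operatorname{domdim}(A)$ is the dominant dimension of the regular module $A_A$. The algebra $A$ is called gendo-symmetric if $\operatorname{domdim}(A)\ge 2$ and $D(Ae)\cong eA$ as $(eAe,A)$-bimodules, where $e$ is an idempotent such that $eA$ is a minimal faithful projective-injective module; $A$ is selfinjective if $A_A$ is injective. The size of a module $M$ is the number of its pairwise non-isomorphic indecomposable direct summands, and $\operatorname{add}(M)$ is the class of direct summands of the modules $M^n$, $n\ge 1$. For $k\ge 1$, $M$ is $k$-rigid if $\operatorname{Ext}_A^i(X,Y)=0$ for all $X,Y\in\operatorname{add}(M)$ and $i=1,\dots,k$. Let $o_k(A)\in\mathbb N\cup\{\infty\}$ be the supremum of the sizes of all $k$-rigid modules. **Theorem.** Let $A$ be a non-selfinjective gendo-symmetric algebra and let $w$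 be the number of isomorphism classes of simple $A$-modules. Then for every $k\ge 1$ $$(o_k(A)+2-w)(k+2)-1\;\ge\;\operatorname{domdim}(A),$$ an inequality in $\mathbb Z\cup\{\infty\}$: if $\operatorname{domdim}(A)=\infty$, then $o_k(A)=\infty$. -/

import Mathlib

open CategoryTheory

noncomputable section

universe u

/-! ### Module categories

The notions in this part are phrased for left modules over a ring `R`. Right modules over an algebra
`A` are the left modules over `Aᵐᵒᵖ`, so everything is later used with `R = Aᵐᵒᵖ`.
When `R` is a finite dimensional algebra over a field, the finite dimensional modules are the
finitely generated ones, and `Ext` over `R` is the usual one. -/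

section Modules

variable {R : Type u} [Ring R]

/-- `X` is (isomorphic to) a direct summand of `M`. -/
def IsDirectSummandOf (X M : ModuleCat.{u} R) : Prop :=
  ∃ Y : ModuleCat.{u} R, Nonempty (M ≃ₗ[R] X × Y)

/-- `X` lies in `add(M)`: it is a direct summand of `M ^ n` for some `n ≥ 1`. -/
def IsInAdd (X M : ModuleCat.{u} R) : Prop :=
  ∃ n : ℕ, 1 ≤ n ∧ IsDirectSummandOf X (ModuleCat.of R (Fin n → M))

/-- The number (in `ℕ∞`) of isomorphism classes of `R`-modules with the property `P`. -/
def countUpToIso (P : ModuleCat.{u} R → Prop) : ℕ∞ :=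
  ((fun X : ModuleCat.{u} R =>
    (Quotient.mk (isIsomorphicSetoid (ModuleCat.{u} R)) X)) '' {X | P X}).encard

/-- The size of `M`: the number of pairwise nonisomorphic indecomposable direct summands. -/
def moduleSize (M : ModuleCat.{u} R) : ℕ∞ :=
  countUpToIso fun X : ModuleCat.{u} R => Indecomposable X ∧ IsDirectSummandOf X M

/-- `M` is `k`-rigid: `Ext ^ i (X, Y) = 0` for all `X, Y` in `add(M)` and `i = 1, …, k`. -/
def IsRigidModule (k : ℕ) (M : ModuleCat.{u} R) : Prop :=
  ∀ X Y : ModuleCat.{u} R, IsInAdd X M → IsInAdd Y M →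
    ∀ i : ℕ, 1 ≤ i → i ≤ k → Subsingleton (Abelian.Ext.{u} X Y i)

/-- An injective resolution `0 → M → I⁰ → I¹ → …` is minimal if every `Iⁿ` is an injective envelope
of the `n`-th cosyzygy, that is, if the kernel of each `Iⁿ → Iⁿ⁺¹` (which is the image of the map
into `Iⁿ`) is an essential submodule of `Iⁿ`. -/
def IsMinimalInjectiveResolution {M : ModuleCat.{u} R} (I : InjectiveResolution M) : Prop :=
  ∀ (n : ℕ) (N : Submodule R (I.cocomplex.X n)),
    N ⊓ LinearMap.ker (I.cocomplex.d n (n + 1)).hom = ⊥ → N = ⊥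

/-- The dominant dimension of `M`: the supremum of all `n` such that the first `n` terms
`I⁰, …, Iⁿ⁻¹` of a minimal injective resolution of `M` are projective. -/
def domDim (M : ModuleCat.{u} R) : ℕ∞ :=
  ⨆ n : {n : ℕ // ∃ I : InjectiveResolution M, IsMinimalInjectiveResolution I ∧
    ∀ i < n, Projective (I.cocomplex.X i)}, ((n : ℕ) : ℕ∞)

/-- `M` is a minimal faithful module: it is faithful, and it is a direct summand of every (finitely
generated) faithful module. -/
def IsMinimalFaithful (M : ModuleCat.{u} R) : Prop :=
  FaithfulSMul R M ∧
    ∀ N : ModuleCat.{u} R, Module.Finite R N → FaithfulSMul R N → IsDirectSummandOf M N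

end Modules

/-! ### Algebras -/

section Algebras

/-- The right `A`-module `e A`. -/
abbrev rightIdealOf {A : Type u} [Ring A] (e : A) : Submodule Aᵐᵒᵖ A :=
  Submodule.span Aᵐᵒᵖ {e}

/-- The left `A`-module `A e`. -/
abbrev leftIdealOf {A : Type u} [Ring A] (e : A) : Submodule A A :=
  Submodule.span A {e}

/-- The dominant dimension of `A`: that of the right regular module. -/
def algDomDim (A : Type u) [Ring A] : ℕ∞ :=
  domDim (ModuleCat.of Aᵐᵒᵖ A)

/-- `A` is selfinjective: the right regular module is injective. -/
def IsSelfinjectiveAlgebra (A : Type u) [Ring A] : Prop :=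
  Module.Injective Aᵐᵒᵖ A

/-- The number of simple right `A`-modules up to isomorphism. -/
def numSimples (A : Type u) [Ring A] : ℕ∞ :=
  countUpToIso fun S : ModuleCat.{u} Aᵐᵒᵖ => IsSimpleModule Aᵐᵒᵖ S

/-- `o_k(A)`: the supremum of the sizes of the (finite dimensional) `k`-rigid right `A`-modules. -/
def rigidSize (k : ℕ) (A : Type u) [Ring A] : ℕ∞ :=
  ⨆ M : {M : ModuleCat.{u} Aᵐᵒᵖ // Module.Finite Aᵐᵒᵖ M ∧ IsRigidModule k M},
    moduleSize (M : ModuleCat.{u} Aᵐᵒᵖ)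

variable (K : Type*) [Field K] {A : Type u} [Ring A] [Algebra K A]

/-- Right multiplication by the element `e a e` of `e A e`, as an endomorphism of `A e`. -/
def cornerRightMul (e a : A) : leftIdealOf e →ₗ[K] leftIdealOf e where
  toFun x := ⟨(x : A) * (e * a * e), Submodule.mem_span_singleton.2
    ⟨(x : A) * (e * a), by simp only [smul_eq_mul, mul_assoc]⟩⟩
  map_add' x y := Subtype.ext (by simp [add_mul])
  map_smul' c x := Subtype.ext (by simp)

/-- `D(A e) ≅ e A` as `(e A e, A)`-bimodules, where `D = Hom_K(-, K)`: a `K`-linear bijection `φ`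
that is right `A`-linear for `(f · a)(x) = f (a x)` and left `e A e`-linear for
`(b · f)(x) = f (x b)`. -/
def DualIsoAsBimodule (e : A) : Prop :=
  ∃ φ : Module.Dual K (leftIdealOf e) ≃ₗ[K] rightIdealOf e,
    (∀ (f : Module.Dual K (leftIdealOf e)) (a : A),
      (φ (f ∘ₗ Algebra.lsmul K K (leftIdealOf e) a) : A) = (φ f : A) * a) ∧
    (∀ (f : Module.Dual K (leftIdealOf e)) (a : A),
      (φ (f ∘ₗ cornerRightMul K e a) : A) = (e * a * e) * (φ f : A))

variable (A) in
/-- `A` is gendo-symmetric: it has dominant dimension at least two, and `D(A e) ≅ e A` as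
`(e A e, A)`-bimodules, where `e` is an idempotent such that `e A` is the minimal faithful
projective-injective right `A`-module. (`e A` is projective because `e` is idempotent.) -/
def IsGendoSymmetric : Prop :=
  2 ≤ algDomDim A ∧
    ∃ e : A, IsIdempotentElem e ∧
      IsMinimalFaithful (ModuleCat.of Aᵐᵒᵖ (rightIdealOf e)) ∧
      Module.Injective Aᵐᵒᵖ (rightIdealOf e) ∧
      DualIsoAsBimodule K e

end Algebras

end

/-!
Let `0 → A → I⁰ → I¹ → …` be a minimal injective resolution of the regular right module with
`I⁰, …, Iⁿ⁻¹` projective, and let `C a` be its `a`-th cosyzygy, so that `C 0 = A`. The point is that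
cosyzygies which are at least `k + 2` steps apart have no extensions of degrees `1, …, k` between
them, so that `C 0, C (k + 2), C (2 (k + 2)), …, C (t (k + 2))` together form a `k`-rigid module
whenever `t (k + 2) ≤ n`.

Since the terms `Iʲ` are injective and, for `j < n`, projective, dimension shifting in both variables
reduces `Extⁱ(C a, C b)` to `Extʲ(A, A)` with `j ≥ 1` if `a < i + b`, and to `Ext¹(C c, A)` with
`3 ≤ c ≤ n` if `i + b + 2 ≤ a` (`InjectiveResolution.subsingleton_ext_cosyzygy`). The first group
vanishes because `A` is projective. The second one vanishes because of the bimodule isomorphism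
`D(A e) ≅ e A`: as `e A` is faithful, every finitely generated projective-injective module `I` is a
summand of a power of `e A` (`nonempty_cornerBasis`), and on such modules `Hom_A(I, A)` and `D(I)` are
naturally isomorphic. Hence `Hom_A(-, A)` preserves exactness of complexes of projective-injective
modules (`DualIsoAsBimodule.exists_comp_eq_of_exact`), that is, every map `C c → A` with
`2 ≤ c < n` extends to `Iᶜ` (`IsGendoSymmetric.exists_extension`).

The size of the rigid module is bounded below through projective dimensions. As `A` is not
injective, `C a` has projective dimension exactly `a` for `1 ≤ a ≤ n`, so it has an indecomposable
summand of projective dimension exactly `a`. These summands are pairwise nonisomorphic and differ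
from the summands of `C 0 = A`, and `A` has at least as many indecomposable summands up to isomorphism
as there are simple modules (`countUpToIso_isSimpleModule_le_moduleSize`). Therefore
`w + t ≤ o_k(A)` for all `t` with `t (k + 2) ≤ n`. As the number `w` of simple modules is finite,
this gives the bound on the dominant dimension.
-/

/-! ### Direct summands and indecomposable modules -/

section Summands

variable {R : Type u} [Ring R]

theorem ModuleCat.isIsomorphic_iff {X Y : ModuleCat.{u} R} :
    IsIsomorphic X Y ↔ Nonempty (X ≃ₗ[R] Y) :=
  ⟨fun ⟨i⟩ => ⟨i.toLinearEquiv⟩, fun ⟨i⟩ => ⟨i.toModuleIso⟩⟩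

theorem Quotient.mk_isIsomorphic_eq_iff {X Y : ModuleCat.{u} R} :
    Quotient.mk (isIsomorphicSetoid (ModuleCat.{u} R)) X = Quotient.mk _ Y ↔
      Nonempty (X ≃ₗ[R] Y) := by
  rw [Quotient.eq]
  exact ModuleCat.isIsomorphic_iff

namespace IsDirectSummandOf

theorem refl (M : ModuleCat.{u} R) : IsDirectSummandOf M M :=
  ⟨ModuleCat.of R PUnit, ⟨LinearEquiv.prodUnique.symm⟩⟩

theorem trans {X Y Z : ModuleCat.{u} R} (h₁ : IsDirectSummandOf X Y)
    (h₂ : IsDirectSummandOf Y Z) : IsDirectSummandOf X Z := by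
  obtain ⟨U, ⟨e⟩⟩ := h₁
  obtain ⟨V, ⟨f⟩⟩ := h₂
  exact ⟨ModuleCat.of R (U × V),
    ⟨f ≪≫ₗ (e.prodCongr (LinearEquiv.refl R V)) ≪≫ₗ LinearEquiv.prodAssoc R X U V⟩⟩

theorem exists_retraction {X M : ModuleCat.{u} R} (h : IsDirectSummandOf X M) :
    ∃ (i : X →ₗ[R] M) (p : M →ₗ[R] X), p ∘ₗ i = LinearMap.id := by
  obtain ⟨U, ⟨e⟩⟩ := h
  exact ⟨e.symm.toLinearMap ∘ₗ LinearMap.inl R X U, LinearMap.fst R X U ∘ₗ e.toLinearMap,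
    by ext; simp⟩

theorem of_retraction {X M : ModuleCat.{u} R} (i : X →ₗ[R] M) (p : M →ₗ[R] X)
    (h : p ∘ₗ i = LinearMap.id) : IsDirectSummandOf X M := by
  have hi : Function.Injective i := LinearMap.injective_of_comp_eq_id i p h
  have hpi : ∀ x, p (i x) = x := LinearMap.congr_fun h
  refine ⟨ModuleCat.of R (LinearMap.ker p), ⟨?_⟩⟩
  have hc : IsCompl (LinearMap.range i) (LinearMap.ker p) := by
    refine ⟨Submodule.disjoint_def.2 ?_, codisjoint_iff.2 (eq_top_iff.2 fun m _ => ?_)⟩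
    · rintro _ ⟨x, rfl⟩ hx
      rw [LinearMap.mem_ker, hpi] at hx
      rw [hx, map_zero]
    · exact Submodule.mem_sup.2 ⟨i (p m), ⟨p m, rfl⟩, m - i (p m), by simp [hpi], by simp⟩
  exact (Submodule.prodEquivOfIsCompl _ _ hc).symm ≪≫ₗ
    ((LinearEquiv.ofInjective i hi).symm.prodCongr (LinearEquiv.refl R _))

end IsDirectSummandOf

theorem CategoryTheory.Indecomposable.subsingleton_or_subsingleton {X : ModuleCat.{u} R}
    (hX : Indecomposable X) {Y Z : Type u} [AddCommGroup Y] [Module R Y] [AddCommGroup Z]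
    [Module R Z] (e : X ≃ₗ[R] Y × Z) : Subsingleton Y ∨ Subsingleton Z := by
  have i : X ≅ (ModuleCat.of R Y ⊞ ModuleCat.of R Z) :=
    e.toModuleIso ≪≫ (ModuleCat.biprodIsoProd (ModuleCat.of R Y) (ModuleCat.of R Z)).symm
  exact (hX.2 _ _ i).imp ModuleCat.subsingleton_of_isZero ModuleCat.subsingleton_of_isZero

/-- A property of modules which holds for zero modules, is stable under direct sums, and holds
for the indecomposable direct summands of a module `M` of finite length, holds for `M`. -/
theorem indecomposable_induction {P : ModuleCat.{u} R → Prop}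
    (zero : ∀ X : ModuleCat.{u} R, Subsingleton X → P X)
    (prod : ∀ M X Y : ModuleCat.{u} R, (M ≃ₗ[R] X × Y) → P X → P Y → P M)
    (M : ModuleCat.{u} R) [IsNoetherian R M] [IsArtinian R M]
    (ind : ∀ X : ModuleCat.{u} R, Indecomposable X → IsDirectSummandOf X M → P X) : P M := by
  obtain ⟨n, hn⟩ : ∃ n : ℕ, Module.length R M = n :=
    ENat.ne_top_iff_exists.1 (Module.length_ne_top (R := R) (M := M)) |>.imp fun _ h => h.symm
  induction n using Nat.strong_induction_on generalizing M with
  | _ n ih =>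
    by_cases h0 : Subsingleton M
    · exact zero M h0
    by_cases hM : Indecomposable M
    · exact ind M hM (.refl M)
    simp only [Indecomposable, not_and, not_forall, not_or] at hM
    obtain ⟨Y, Z, i, hY, hZ⟩ := hM fun h => h0 (ModuleCat.subsingleton_of_isZero h)
    let e : M ≃ₗ[R] Y × Z := (i ≪≫ ModuleCat.biprodIsoProd Y Z).toLinearEquiv
    have hY' : ¬ Subsingleton Y := fun h => hY (ModuleCat.isZero_of_subsingleton Y)
    have hZ' : ¬ Subsingleton Z := fun h => hZ (ModuleCat.isZero_of_subsingleton Z)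
    have : IsNoetherian R (Y × Z) := isNoetherian_of_linearEquiv e
    have : IsArtinian R (Y × Z) := e.isArtinian_iff.1 inferInstance
    have : IsNoetherian R Y := isNoetherian_of_surjective (LinearMap.fst R Y Z)
      (LinearMap.range_eq_top.2 Prod.fst_surjective)
    have : IsNoetherian R Z := isNoetherian_of_surjective (LinearMap.snd R Y Z)
      (LinearMap.range_eq_top.2 Prod.snd_surjective)
    have : IsArtinian R Y := isArtinian_of_surjective _ (LinearMap.fst R Y Z) Prod.fst_surjective
    have : IsArtinian R Z := isArtinian_of_surjective _ (LinearMap.snd R Y Z) Prod.snd_surjective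
    obtain ⟨a, ha⟩ := ENat.ne_top_iff_exists.1 (Module.length_ne_top (R := R) (M := Y))
    obtain ⟨b, hb⟩ := ENat.ne_top_iff_exists.1 (Module.length_ne_top (R := R) (M := Z))
    have hab : a + b = n := by
      have := (e.length_eq.symm.trans hn).symm.trans (Module.length_prod R Y Z)
      rw [← ha, ← hb] at this
      exact_mod_cast this.symm
    have ha0 : a ≠ 0 := by
      rintro rfl
      exact hY' (Module.length_eq_zero_iff.1 (by simpa using ha.symm))
    have hb0 : b ≠ 0 := by
      rintro rfl
      exact hZ' (Module.length_eq_zero_iff.1 (by simpa using hb.symm))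
    have sY : IsDirectSummandOf Y M := ⟨Z, ⟨e⟩⟩
    have sZ : IsDirectSummandOf Z M := ⟨Y, ⟨e ≪≫ₗ LinearEquiv.prodComm R Y Z⟩⟩
    exact prod M Y Z e
      (ih a (by omega) Y (fun X hX hXY => ind X hX (hXY.trans sY)) ha.symm)
      (ih b (by omega) Z (fun X hX hXZ => ind X hX (hXZ.trans sZ)) hb.symm)

/-- An indecomposable projective module of finite length has at most one simple quotient. If `f` and
`g` are maps onto nonisomorphic simple modules `S` and `S'`, then `(f, 0)` lifts along `(f, g)` to an
endomorphism which is neither nilpotent nor invertible, against Fitting's lemma. -/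
theorem CategoryTheory.Indecomposable.nonempty_linearEquiv_of_surjective {P : ModuleCat.{u} R}
    (hP : Indecomposable P) [Module.Projective R P] [IsNoetherian R P] [IsArtinian R P]
    {S S' : Type u} [AddCommGroup S] [Module R S] [AddCommGroup S'] [Module R S']
    [IsSimpleModule R S] [IsSimpleModule R S'] {f : P →ₗ[R] S} {g : P →ₗ[R] S'}
    (hf : Function.Surjective f) (hg : Function.Surjective g) : Nonempty (S ≃ₗ[R] S') := by
  by_contra hne
  -- Both kernels are maximal submodules, so an inclusion would make them equal.
  have hker : ¬ LinearMap.ker f ≤ LinearMap.ker g := by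
    intro hle
    have hmax : IsCoatom (LinearMap.ker f) := LinearMap.isCoatom_ker_of_surjective hf
    have hg1 : LinearMap.ker g ≠ ⊤ := (LinearMap.isCoatom_ker_of_surjective hg).1
    have heq : LinearMap.ker f = LinearMap.ker g :=
      (hmax.le_iff.1 hle).resolve_left hg1 |>.symm
    exact hne ⟨(f.quotKerEquivOfSurjective hf).symm ≪≫ₗ Submodule.quotEquivOfEq _ _ heq ≪≫ₗ
      g.quotKerEquivOfSurjective hg⟩
  have hgr : Function.Surjective (g.domRestrict (LinearMap.ker f)) := by
    refine (LinearMap.surjective_or_eq_zero _).resolve_right fun h => hker fun x hx => ?_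
    exact LinearMap.congr_fun h ⟨x, hx⟩
  have hsurj : Function.Surjective (f.prod g) := by
    rintro ⟨s, s'⟩
    obtain ⟨p, rfl⟩ := hf s
    obtain ⟨⟨q, hq⟩, hq'⟩ := hgr (s' - g p)
    refine ⟨p + q, Prod.ext ?_ ?_⟩
    · simpa using hq
    · have : g q = s' - g p := hq'
      simp [this]
  obtain ⟨φ, hφ⟩ := Module.projective_lifting_property (f.prod g)
    ((LinearMap.inl R S S').comp f) hsurj
  have hfφ : ∀ x, f (φ x) = f x := fun x => by
    simpa using congrArg _root_.Prod.fst (LinearMap.congr_fun hφ x)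
  have hgφ : ∀ x, g (φ x) = 0 := fun x => by
    simpa using congrArg _root_.Prod.snd (LinearMap.congr_fun hφ x)
  obtain ⟨n, hn, hc⟩ := ((Filter.eventually_ge_atTop 1).and
    (LinearMap.eventually_isCompl_ker_pow_range_pow φ)).exists
  have hfn : ∀ (m : ℕ) x, f ((φ ^ m) x) = f x := by
    intro m
    induction m with
    | zero => simp
    | succ m ihm => intro x; rw [pow_succ', Module.End.mul_apply, hfφ, ihm]
  have hS : Nontrivial S := IsSimpleModule.nontrivial R S
  have hS' : Nontrivial S' := IsSimpleModule.nontrivial R S'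
  rcases hP.subsingleton_or_subsingleton (Submodule.prodEquivOfIsCompl _ _ hc).symm with h | h
  · have hr : LinearMap.range (φ ^ n) = ⊤ := by
      have := hc.sup_eq_top
      rwa [(Submodule.subsingleton_iff_eq_bot).1 h, bot_sup_eq] at this
    obtain ⟨s', hs'⟩ := exists_ne (0 : S')
    obtain ⟨x, rfl⟩ := hg s'
    obtain ⟨y, rfl⟩ := LinearMap.range_eq_top.1 hr x
    obtain ⟨m, rfl⟩ := Nat.exists_eq_add_of_le' hn
    exact hs' (by rw [pow_succ', Module.End.mul_apply, hgφ])
  · have hr : φ ^ n = 0 := LinearMap.range_eq_bot.1 ((Submodule.subsingleton_iff_eq_bot).1 h)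
    obtain ⟨s, hs⟩ := exists_ne (0 : S)
    obtain ⟨x, rfl⟩ := hf s
    exact hs (by rw [← hfn n x, hr]; simp)

/-! ### Counting isomorphism classes -/

/-- Isomorphism classes with `P` inject into isomorphism classes with `Q` along a relation that is
total on the `P` side and determines the related `X` up to isomorphism. -/
theorem countUpToIso_le_of_rel {P Q : ModuleCat.{u} R → Prop}
    (r : ModuleCat.{u} R → ModuleCat.{u} R → Prop) (h₁ : ∀ X, P X → ∃ Y, Q Y ∧ r X Y)
    (h₂ : ∀ X X' Y Y', P X → P X' → Q Y → Q Y' → r X Y → r X' Y' → Nonempty (Y ≃ₗ[R] Y') →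
      Nonempty (X ≃ₗ[R] X')) :
    countUpToIso P ≤ countUpToIso Q := by
  have h : ∀ q ∈ (fun X : ModuleCat.{u} R =>
      Quotient.mk (isIsomorphicSetoid (ModuleCat.{u} R)) X) '' {X | P X},
      ∃ X Y, Quotient.mk _ X = q ∧ P X ∧ Q Y ∧ r X Y := by
    rintro _ ⟨X, hX, rfl⟩
    obtain ⟨Y, hY, hr⟩ := h₁ X hX
    exact ⟨X, Y, rfl, hX, hY, hr⟩
  choose! F G hF hP hQ hr using h
  refine Set.encard_le_encard_of_injOn (f := fun q => Quotient.mk _ (G q))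
    (fun q hq => ⟨G q, hQ q hq, rfl⟩) ?_
  intro q hq q' hq' hqq'
  rw [← hF q hq, ← hF q' hq', Quotient.mk_isIsomorphic_eq_iff]
  exact h₂ _ _ _ _ (hP q hq) (hP q' hq') (hQ q hq) (hQ q' hq') (hr q hq) (hr q' hq')
    (Quotient.mk_isIsomorphic_eq_iff.1 hqq')

theorem exists_surjective_of_isSimpleModule (S : Type u) [AddCommGroup S] [Module R S]
    [IsSimpleModule R S] : ∃ f : R →ₗ[R] S, Function.Surjective f := by
  have := IsSimpleModule.nontrivial R S
  obtain ⟨s, hs⟩ := exists_ne (0 : S)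
  exact ⟨LinearMap.toSpanSingleton R S s, IsSimpleModule.toSpanSingleton_surjective R hs⟩

/-- A simple quotient of a direct sum is a quotient of one of the summands. -/
theorem exists_surjective_of_surjective_prod {X Y S : Type u} [AddCommGroup X] [Module R X]
    [AddCommGroup Y] [Module R Y] [AddCommGroup S] [Module R S] [IsSimpleModule R S]
    {f : X × Y →ₗ[R] S} (hf : Function.Surjective f) :
    (∃ g : X →ₗ[R] S, Function.Surjective g) ∨ ∃ g : Y →ₗ[R] S, Function.Surjective g := by
  rcases LinearMap.surjective_or_eq_zero (f ∘ₗ LinearMap.inl R X Y) with h | h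
  · exact .inl ⟨_, h⟩
  rcases LinearMap.surjective_or_eq_zero (f ∘ₗ LinearMap.inr R X Y) with h' | h'
  · exact .inr ⟨_, h'⟩
  have := IsSimpleModule.nontrivial R S
  obtain ⟨s, hs⟩ := exists_ne (0 : S)
  obtain ⟨x, rfl⟩ := hf s
  have hx : f = 0 := LinearMap.prod_ext h h'
  simp [hx] at hs

theorem IsDirectSummandOf.projective_of_self {P : ModuleCat.{u} R}
    (h : IsDirectSummandOf P (ModuleCat.of R R)) : Module.Projective R P := by
  obtain ⟨i, p, hip⟩ := h.exists_retraction
  exact Module.Projective.of_split (M := ModuleCat.of R R) i p hip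

theorem IsDirectSummandOf.isNoetherian {X M : ModuleCat.{u} R} (h : IsDirectSummandOf X M)
    [IsNoetherian R M] : IsNoetherian R X := by
  obtain ⟨i, p, hip⟩ := h.exists_retraction
  exact isNoetherian_of_surjective p
    (LinearMap.range_eq_top.2 fun x => ⟨i x, LinearMap.congr_fun hip x⟩)

theorem IsDirectSummandOf.isArtinian {X M : ModuleCat.{u} R} (h : IsDirectSummandOf X M)
    [IsArtinian R M] : IsArtinian R X := by
  obtain ⟨i, p, hip⟩ := h.exists_retraction
  exact isArtinian_of_surjective _ p fun x => ⟨i x, LinearMap.congr_fun hip x⟩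

variable (R)

/-- Sending a simple module to an indecomposable projective module that maps onto it shows that
there are at most as many simple modules as indecomposable summands of the regular module. -/
theorem countUpToIso_isSimpleModule_le_moduleSize [IsNoetherianRing R] [IsArtinianRing R] :
    countUpToIso (fun S : ModuleCat.{u} R => IsSimpleModule R S) ≤
      moduleSize (ModuleCat.of R R) := by
  refine countUpToIso_le_of_rel (fun S P => ∃ f : P →ₗ[R] S, Function.Surjective f) ?_ ?_
  · intro S hS
    have hR : IsNoetherian R (ModuleCat.of R R) := inferInstanceAs (IsNoetherian R R)
    have hR' : IsArtinian R (ModuleCat.of R R) := inferInstanceAs (IsArtinian R R)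
    have := indecomposable_induction (R := R)
      (P := fun X => (∃ f : X →ₗ[R] S, Function.Surjective f) →
        ∃ Y : ModuleCat.{u} R, (Indecomposable Y ∧ IsDirectSummandOf Y (ModuleCat.of R R)) ∧
          ∃ f : Y →ₗ[R] S, Function.Surjective f) ?_ ?_ (ModuleCat.of R R)
        (fun X hX hXR hf => ⟨X, ⟨hX, hXR⟩, hf⟩)
    · exact this (exists_surjective_of_isSimpleModule S)
    · rintro X hX ⟨f, hf⟩
      exact (not_subsingleton_iff_nontrivial.2 (IsSimpleModule.nontrivial R S)
        hf.subsingleton).elim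
    · rintro M X Y e hX hY ⟨f, hf⟩
      rcases exists_surjective_of_surjective_prod (f := f ∘ₗ e.symm.toLinearMap)
        (hf.comp e.symm.surjective) with h | h
      exacts [hX h, hY h]
  · rintro S S' P P' hS hS' ⟨hP, hPR⟩ - ⟨f, hf⟩ ⟨f', hf'⟩ ⟨e⟩
    have hR : IsNoetherian R (ModuleCat.of R R) := inferInstanceAs (IsNoetherian R R)
    have hR' : IsArtinian R (ModuleCat.of R R) := inferInstanceAs (IsArtinian R R)
    have := hPR.projective_of_self
    have := hPR.isNoetherian
    have := hPR.isArtinian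
    exact hP.nonempty_linearEquiv_of_surjective hf (g := f' ∘ₗ e.toLinearMap)
      (hf'.comp e.surjective)

/-- Every simple module is a quotient of one of the finitely many indecomposable summands in a
decomposition of the regular module, each of which has only one simple quotient. -/
theorem countUpToIso_isSimpleModule_ne_top [IsNoetherianRing R] [IsArtinianRing R] :
    countUpToIso (fun S : ModuleCat.{u} R => IsSimpleModule R S) ≠ ⊤ := by
  have hR : IsNoetherian R (ModuleCat.of R R) := inferInstanceAs (IsNoetherian R R)
  have hR' : IsArtinian R (ModuleCat.of R R) := inferInstanceAs (IsArtinian R R)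
  let Q (X : ModuleCat.{u} R) : Set (Quotient (isIsomorphicSetoid (ModuleCat.{u} R))) :=
    (fun S : ModuleCat.{u} R => Quotient.mk _ S) ''
      {S | IsSimpleModule R S ∧ ∃ f : X →ₗ[R] S, Function.Surjective f}
  have hQ : (Q (ModuleCat.of R R)).Finite := by
    refine indecomposable_induction (R := R) (P := fun X => (Q X).Finite) ?_ ?_ _ ?_
    · intro X hX
      convert Set.finite_empty
      rw [Set.eq_empty_iff_forall_notMem]
      rintro _ ⟨S, ⟨hS, f, hf⟩, rfl⟩
      exact not_subsingleton_iff_nontrivial.2 (IsSimpleModule.nontrivial R S) hf.subsingleton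
    · intro M X Y e hX hY
      refine (hX.union hY).subset ?_
      rintro _ ⟨S, ⟨hS, f, hf⟩, rfl⟩
      rcases exists_surjective_of_surjective_prod (f := f ∘ₗ e.symm.toLinearMap)
        (hf.comp e.symm.surjective) with h | h
      exacts [.inl ⟨S, ⟨hS, h⟩, rfl⟩, .inr ⟨S, ⟨hS, h⟩, rfl⟩]
    · intro X hX hXR
      have := hXR.projective_of_self
      have := hXR.isNoetherian
      have := hXR.isArtinian
      refine Set.Subsingleton.finite ?_
      rintro _ ⟨S, ⟨hS, f, hf⟩, rfl⟩ _ ⟨S', ⟨hS', f', hf'⟩, rfl⟩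
      exact Quotient.mk_isIsomorphic_eq_iff.2 (hX.nonempty_linearEquiv_of_surjective hf hf')
  refine Set.encard_ne_top_iff.2 (hQ.subset ?_)
  rintro _ ⟨S, hS, rfl⟩
  have : IsSimpleModule R S := hS
  exact ⟨S, ⟨hS, exists_surjective_of_isSimpleModule S⟩, rfl⟩

end Summands

/-! ### Essential extensions -/

/-- An essential extension `I` of a finite dimensional module `N` is finite dimensional. If
`p : I → N` is a linear retraction, then `x ↦ (r ↦ p (r x))` embeds `I` into `Hom_K(R, N)`: its
kernel is a submodule of `I` that meets `N` trivially. -/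
theorem Module.Finite.of_essential (K : Type*) [Field K] {R : Type*} [Ring R] [Algebra K R]
    [FiniteDimensional K R] {I : Type*} [AddCommGroup I] [Module R I] (N : Submodule R I)
    [Module.Finite R N] (h : ∀ L : Submodule R I, L ⊓ N = ⊥ → L = ⊥) : Module.Finite R I := by
  let : Module K I := Module.compHom I (algebraMap K R)
  have : IsScalarTower K R I := IsScalarTower.of_algebraMap_smul fun _ _ => rfl
  have : SMulCommClass R K I := inferInstance
  have : Module.Finite K N := Module.Finite.trans R N
  obtain ⟨p, hp⟩ := (N.subtype.restrictScalars K).exists_leftInverse_of_injective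
    (LinearMap.ker_eq_bot.2 N.injective_subtype)
  let Φ : I →ₗ[K] R →ₗ[K] N := LinearMap.mk₂ K (fun x r => p (r • x))
    (fun x y r => by rw [smul_add, map_add])
    (fun c x r => by rw [smul_comm, map_smul])
    (fun x r s => by rw [add_smul, map_add])
    (fun c x r => by rw [smul_assoc, map_smul])
  let L : Submodule R I :=
    { carrier := {x | ∀ r : R, p (r • x) = 0}
      add_mem' := fun hx hy r => by rw [smul_add, map_add, hx r, hy r, add_zero]
      zero_mem' := fun r => by rw [smul_zero, map_zero]
      smul_mem' := fun s x hx r => by rw [smul_smul]; exact hx (r * s) }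
  have hL : L = ⊥ := by
    refine h L (eq_bot_iff.2 ?_)
    rintro x ⟨hx, hxN⟩
    have h1 : p x = 0 := by simpa using hx 1
    have h2 : p x = ⟨x, hxN⟩ := LinearMap.congr_fun hp ⟨x, hxN⟩
    exact congrArg Subtype.val (h2.symm.trans h1)
  have hΦ : Function.Injective Φ := by
    refine (injective_iff_map_eq_zero Φ).2 fun x hx => ?_
    have : x ∈ L := fun r => LinearMap.congr_fun hx r
    rwa [hL] at this
  have : Module.Finite K I := Module.Finite.of_injective Φ hΦ
  exact Module.Finite.of_restrictScalars_finite K R I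

/-! ### Duality on projective-injective modules -/

section Duality

open MulOpposite

variable {K : Type*} [Field K] {A : Type u} [Ring A] [Algebra K A]

theorem IsIdempotentElem.mul_rightIdealOf {e : A} (he : IsIdempotentElem e) (y : rightIdealOf e) :
    e * (y : A) = y := by
  obtain ⟨a, ha⟩ := Submodule.mem_span_singleton.1 y.2
  rw [← ha, MulOpposite.smul_eq_mul_unop, ← mul_assoc, he.eq]

theorem IsIdempotentElem.leftIdealOf_mul {e : A} (he : IsIdempotentElem e) (x : leftIdealOf e) :
    (x : A) * e = x := by
  obtain ⟨a, ha⟩ := Submodule.mem_span_singleton.1 x.2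
  rw [← ha, smul_eq_mul, mul_assoc, he.eq]

theorem mul_mem_leftIdealOf (e x : A) : x * e ∈ leftIdealOf e :=
  Submodule.mem_span_singleton.2 ⟨x, rfl⟩

/-- A bimodule isomorphism `D(A e) ≅ e A` amounts to a perfect pairing between `A e` and `e A` that
is balanced over `e A e`. It is stated here as a form `β` on `A × e A` with `β x y = β (x e) y`. -/
theorem DualIsoAsBimodule.exists_pairing [FiniteDimensional K A] {e : A}
    (he : IsIdempotentElem e) (h : DualIsoAsBimodule K e) :
    ∃ β : A →ₗ[K] rightIdealOf e →ₗ[K] K,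
      (∀ x (u y : rightIdealOf e), β x (op (y : A) • u) = β (x * u) y) ∧
      (∀ x, (∀ y, β x y = 0) → x * e = 0) ∧
      (∀ ξ : rightIdealOf e →ₗ[K] K, ∃ x, ∀ y, β x y = ξ y) := by
  obtain ⟨φ, -, hφ⟩ := h
  let β : A →ₗ[K] rightIdealOf e →ₗ[K] K := LinearMap.mk₂ K
    (fun x y => φ.symm y ⟨x * e, mul_mem_leftIdealOf e x⟩)
    (fun x x' y => by
      rw [← map_add]; exact congrArg _ (Subtype.ext (add_mul x x' e)))
    (fun c x y => by
      rw [← map_smul]; exact congrArg _ (Subtype.ext (smul_mul_assoc c x e)))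
    (fun x y y' => by rw [map_add, LinearMap.add_apply])
    (fun c x y => by rw [map_smul, LinearMap.smul_apply])
  have hβ : ∀ x y, β x y = φ.symm y ⟨x * e, mul_mem_leftIdealOf e x⟩ := fun _ _ => rfl
  have hfin : FiniteDimensional K (leftIdealOf e) :=
    inferInstanceAs (FiniteDimensional K ((leftIdealOf e).restrictScalars K))
  refine ⟨β, fun x u y => ?_, fun x hx => ?_, fun ξ => ?_⟩
  -- The left action of `e u e = u` on `e A` is dual to right multiplication by it on `A e`.
  · have h1 : φ.symm (op (y : A) • u) = φ.symm y ∘ₗ cornerRightMul K e (u : A) := by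
      rw [LinearEquiv.symm_apply_eq]
      refine Subtype.ext ?_
      rw [hφ, LinearEquiv.apply_symm_apply, mul_assoc, he.mul_rightIdealOf,
        he.mul_rightIdealOf]
      rfl
    rw [hβ, hβ, h1]
    refine congrArg (φ.symm y) (Subtype.ext ?_)
    change x * e * (e * u * e) = x * u * e
    rw [he.mul_rightIdealOf, mul_assoc x e, ← mul_assoc e, he.mul_rightIdealOf, ← mul_assoc]
  · have : (⟨x * e, mul_mem_leftIdealOf e x⟩ : leftIdealOf e) = 0 := by
      refine (Module.forall_dual_apply_eq_zero_iff K _).1 fun f => ?_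
      simpa [hβ] using hx (φ f)
    exact congrArg Subtype.val this
  · let x := (Module.evalEquiv K (leftIdealOf e)).symm (ξ ∘ₗ φ.toLinearMap)
    refine ⟨x, fun y => ?_⟩
    have hx : (⟨(x : A) * e, mul_mem_leftIdealOf e x⟩ : leftIdealOf e) = x :=
      Subtype.ext (he.leftIdealOf_mul x)
    rw [hβ, hx, Module.apply_evalEquiv_symm_apply]
    simp

/-- A dual basis which exhibits a module as a direct summand of a power of `e A`: elements `u i` and
coordinates `c i` with values in `e A`, such that every `v` is the sum of the `u i * c i v`. -/
structure CornerBasis (e : A) (I : Type u) [AddCommGroup I] [Module Aᵐᵒᵖ I] where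
  /-- the index set -/
  ι : Type u
  [fintype : Fintype ι]
  /-- the elements -/
  u : ι → I
  /-- the coordinates -/
  c : ι → I →ₗ[Aᵐᵒᵖ] rightIdealOf e
  sum_smul : ∀ v, ∑ i, op (c i v : A) • u i = v

attribute [instance] CornerBasis.fintype

variable (K) in
/-- When `e A` is faithful, every finitely generated projective-injective module is a summand of a
power of `e A`, because the regular module embeds into such a power. -/
theorem nonempty_cornerBasis [FiniteDimensional K A] {e : A} (he : IsIdempotentElem e)
    [FaithfulSMul Aᵐᵒᵖ (rightIdealOf e)]
    (I : Type u) [AddCommGroup I] [Module Aᵐᵒᵖ I] [Module.Finite Aᵐᵒᵖ I]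
    [Module.Projective Aᵐᵒᵖ I] [Module.Injective Aᵐᵒᵖ I] : Nonempty (CornerBasis e I) := by
  classical
  have hfin : FiniteDimensional K (rightIdealOf e) :=
    inferInstanceAs (FiniteDimensional K ((rightIdealOf e).restrictScalars K))
  let b := Module.Free.chooseBasis K (rightIdealOf e)
  obtain ⟨m, s, hs⟩ := Module.Finite.exists_fin' Aᵐᵒᵖ I
  obtain ⟨t, ht⟩ := Module.projective_lifting_property s LinearMap.id hs
  have ht' : ∀ v, s (t v) = v := LinearMap.congr_fun ht
  let h : I →ₗ[Aᵐᵒᵖ] (Fin m × Module.Free.ChooseBasisIndex K (rightIdealOf e)) → rightIdealOf e :=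
    LinearMap.pi fun ij => LinearMap.toSpanSingleton Aᵐᵒᵖ _ (b ij.2) ∘ₗ LinearMap.proj ij.1 ∘ₗ t
  have hh : Function.Injective h := by
    refine (injective_iff_map_eq_zero h).2 fun v hv => ?_
    have htv : t v = 0 := by
      funext i
      refine FaithfulSMul.eq_of_smul_eq_smul (α := rightIdealOf e) fun y => ?_
      have hlin : Algebra.lsmul K K (rightIdealOf e) (t v i) = 0 :=
        b.ext fun j => congrFun hv (i, j)
      rw [Pi.zero_apply, zero_smul]
      exact LinearMap.congr_fun hlin y
    rw [← ht' v, htv, map_zero]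
  obtain ⟨π, hπ⟩ := Module.Injective.out h hh LinearMap.id
  have heI : e ∈ rightIdealOf e := Submodule.mem_span_singleton_self e
  refine ⟨⟨_, fun ij => π (Pi.single ij ⟨e, heI⟩), fun ij => LinearMap.proj ij ∘ₗ h, fun v => ?_⟩⟩
  have hsingle : ∀ ij, op (h v ij : A) • (⟨e, heI⟩ : rightIdealOf e) = h v ij := fun ij =>
    Subtype.ext (he.mul_rightIdealOf (h v ij))
  calc ∑ ij, op (h v ij : A) • π (Pi.single ij ⟨e, heI⟩)
      = ∑ ij, π (Pi.single ij (h v ij)) := Finset.sum_congr rfl fun ij _ => by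
        rw [← map_smul, ← Pi.single_smul, hsingle]
    _ = π (h v) := by rw [← map_sum, Finset.univ_sum_single]
    _ = v := hπ v

namespace CornerBasis

variable {e : A} {β : A →ₗ[K] rightIdealOf e →ₗ[K] K} {I : Type u}
  [AddCommGroup I] [Module Aᵐᵒᵖ I] [Module K I]

theorem map_eq_sum (B : CornerBasis e I) (f : I →ₗ[Aᵐᵒᵖ] A) (v : I) :
    f v = ∑ i, f (B.u i) * (B.c i v : A) := by
  conv_lhs => rw [← B.sum_smul v, map_sum]
  simp

/-- The functional `ξ` on `I` corresponds to the map `f : I → A` under the isomorphism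
`Hom_A(I, A) ≅ D(I)`. For `I = e A` this is the isomorphism `A e ≅ D(e A)` given by `β`. -/
def Corresponds (β : A →ₗ[K] rightIdealOf e →ₗ[K] K) (f : I →ₗ[Aᵐᵒᵖ] A) (ξ : I →ₗ[K] K) : Prop :=
  ∀ v (y : rightIdealOf e), ξ (op (y : A) • v) = β (f v) y

variable (B : CornerBasis e I)
include B

/-- The functional is `v ↦ ∑ i, β (f (u i)) (c i v)`. -/
theorem exists_functional [IsScalarTower K Aᵐᵒᵖ I]
    (hβ : ∀ x (u y : rightIdealOf e), β x (op (y : A) • u) = β (x * u) y)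
    (f : I →ₗ[Aᵐᵒᵖ] A) : ∃ ξ : I →ₗ[K] K, Corresponds β f ξ := by
  refine ⟨∑ i, β (f (B.u i)) ∘ₗ (B.c i).restrictScalars K, fun v y => ?_⟩
  rw [B.map_eq_sum f v]
  simp [hβ]

/-- The map is `v ↦ ∑ i, x i * c i v`, where `x i` represents the functional `y ↦ ξ (u i * y)` on
`e A` through `β`. -/
theorem exists_hom [IsScalarTower K Aᵐᵒᵖ I]
    (hβ : ∀ x (u y : rightIdealOf e), β x (op (y : A) • u) = β (x * u) y)
    (hβ' : ∀ ξ : rightIdealOf e →ₗ[K] K, ∃ x, ∀ y, β x y = ξ y) (ξ : I →ₗ[K] K) :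
    ∃ f : I →ₗ[Aᵐᵒᵖ] A, Corresponds β f ξ := by
  let η (i : B.ι) : rightIdealOf e →ₗ[K] K :=
    { toFun := fun y => ξ (op (y : A) • B.u i)
      map_add' := fun y z => by
        rw [Submodule.coe_add, MulOpposite.op_add, add_smul, map_add]
      map_smul' := fun a y => by
        rw [Submodule.coe_smul_of_tower, MulOpposite.op_smul, smul_assoc, map_smul, RingHom.id_apply] }
  choose x hx using fun i => hβ' (η i)
  refine ⟨∑ i, Module.toModuleEnd Aᵐᵒᵖ A (x i) ∘ₗ (rightIdealOf e).subtype ∘ₗ B.c i,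
    fun v y => ?_⟩
  have h1 : (∑ i, Module.toModuleEnd Aᵐᵒᵖ A (x i) ∘ₗ (rightIdealOf e).subtype ∘ₗ B.c i) v =
      ∑ i, x i * (B.c i v : A) := by
    simp
  rw [h1, map_sum, LinearMap.sum_apply]
  conv_lhs => rw [← B.sum_smul (op (y : A) • v), map_sum]
  refine Finset.sum_congr rfl fun i _ => ?_
  rw [← hβ, hx, (B.c i).map_smul]
  rfl

theorem functional_eq_zero {ξ : I →ₗ[K] K} (h : Corresponds β 0 ξ) : ξ = 0 := by
  ext v
  rw [← B.sum_smul v, map_sum]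
  simp [h _ _]

theorem hom_eq_zero (he : IsIdempotentElem e) (hβ : ∀ x, (∀ y, β x y = 0) → x * e = 0)
    {f : I →ₗ[Aᵐᵒᵖ] A} (h : Corresponds β f 0) : f = 0 := by
  ext v
  rw [B.map_eq_sum, LinearMap.zero_apply]
  refine Finset.sum_eq_zero fun i _ => ?_
  rw [← he.mul_rightIdealOf, ← mul_assoc, hβ _ fun y => (h _ y).symm, zero_mul]

end CornerBasis

/-- For projective-injective modules `I` the functors `Hom_A(I, A)` and `D(I)` are isomorphic, so
`Hom_A(-, A)` is exact on exact sequences of projective-injective modules. -/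
theorem DualIsoAsBimodule.exists_comp_eq_of_exact [FiniteDimensional K A] {e : A}
    (he : IsIdempotentElem e) (h : DualIsoAsBimodule K e) {I₁ I₂ I₃ : Type u}
    [AddCommGroup I₁] [Module Aᵐᵒᵖ I₁] [AddCommGroup I₂] [Module Aᵐᵒᵖ I₂]
    [AddCommGroup I₃] [Module Aᵐᵒᵖ I₃] (B₁ : CornerBasis e I₁) (B₂ : CornerBasis e I₂)
    (B₃ : CornerBasis e I₃) {d : I₁ →ₗ[Aᵐᵒᵖ] I₂} {d' : I₂ →ₗ[Aᵐᵒᵖ] I₃}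
    (hd : Function.Exact d d') (f : I₂ →ₗ[Aᵐᵒᵖ] A) (hf : f ∘ₗ d = 0) :
    ∃ g : I₃ →ₗ[Aᵐᵒᵖ] A, g ∘ₗ d' = f := by
  let : Module K I₁ := Module.compHom I₁ (algebraMap K Aᵐᵒᵖ)
  let : Module K I₂ := Module.compHom I₂ (algebraMap K Aᵐᵒᵖ)
  let : Module K I₃ := Module.compHom I₃ (algebraMap K Aᵐᵒᵖ)
  have : IsScalarTower K Aᵐᵒᵖ I₁ := IsScalarTower.of_algebraMap_smul fun _ _ => rfl
  have : IsScalarTower K Aᵐᵒᵖ I₂ := IsScalarTower.of_algebraMap_smul fun _ _ => rfl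
  have : IsScalarTower K Aᵐᵒᵖ I₃ := IsScalarTower.of_algebraMap_smul fun _ _ => rfl
  obtain ⟨β, hβ, hβ₁, hβ₂⟩ := h.exists_pairing he
  obtain ⟨ξ, hξ⟩ := B₂.exists_functional hβ f
  have hξd : ξ ∘ₗ d.restrictScalars K = 0 := by
    refine B₁.functional_eq_zero (β := β) fun v y => ?_
    have hv : f (d v) = 0 := LinearMap.congr_fun hf v
    simpa [hv] using hξ (d v) y
  have hker : LinearMap.ker (d'.restrictScalars K) ≤ LinearMap.ker ξ := by
    intro v hv
    obtain ⟨w, rfl⟩ := (hd v).1 hv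
    exact LinearMap.congr_fun hξd w
  obtain ⟨η, hη⟩ : ξ ∈ LinearMap.range (d'.restrictScalars K).dualMap := by
    rw [LinearMap.range_dualMap_eq_dualAnnihilator_ker, Submodule.mem_dualAnnihilator]
    exact fun v hv => hker hv
  obtain ⟨g, hg⟩ := B₃.exists_hom hβ hβ₂ η
  refine ⟨g, sub_eq_zero.1 (B₂.hom_eq_zero he hβ₁ fun v y => ?_)⟩
  have h1 : ξ (op (y : A) • v) = η (op (y : A) • d' v) := by
    rw [← hη, ← d'.map_smul]
    rfl
  rw [LinearMap.sub_apply, map_sub, LinearMap.sub_apply, ← hξ v y, LinearMap.comp_apply,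
    ← hg (d' v) y, h1, sub_self, LinearMap.zero_apply]

end Duality

/-! ### Vanishing of extension groups -/

section Ext

open Abelian

universe w v v'

variable {C : Type v'} [Category.{v} C] [Abelian C] [HasExt.{w} C]

theorem CategoryTheory.Abelian.Ext.subsingleton_of_sum_eq_id_left {ι : Type*} [Fintype ι] {X Y : C}
    {W : ι → C} (p : ∀ i, X ⟶ W i) (q : ∀ i, W i ⟶ X) (h : ∑ i, p i ≫ q i = 𝟙 X) {n : ℕ}
    (hW : ∀ i, Subsingleton (Ext.{w} (W i) Y n)) : Subsingleton (Ext.{w} X Y n) := by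
  refine subsingleton_of_forall_eq 0 fun x => ?_
  rw [← x.mk₀_id_comp, ← h, Ext.mk₀_sum, Ext.sum_comp]
  refine Finset.sum_eq_zero fun i _ => ?_
  rw [← Ext.mk₀_comp_mk₀_assoc, Subsingleton.elim ((Ext.mk₀ (q i)).comp x (zero_add n)) 0,
    Ext.comp_zero]

theorem CategoryTheory.Abelian.Ext.subsingleton_of_sum_eq_id_right {ι : Type*} [Fintype ι]
    {X Y : C} {W : ι → C} (p : ∀ i, Y ⟶ W i) (q : ∀ i, W i ⟶ Y) (h : ∑ i, p i ≫ q i = 𝟙 Y) {n : ℕ}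
    (hW : ∀ i, Subsingleton (Ext.{w} X (W i) n)) : Subsingleton (Ext.{w} X Y n) := by
  refine subsingleton_of_forall_eq 0 fun x => ?_
  rw [← x.comp_mk₀_id, ← h, Ext.mk₀_sum, Ext.comp_sum]
  refine Finset.sum_eq_zero fun i _ => ?_
  rw [← Ext.mk₀_comp_mk₀, ← Ext.comp_assoc_of_third_deg_zero,
    Subsingleton.elim (x.comp (Ext.mk₀ (p i)) (add_zero n)) 0, Ext.zero_comp]

namespace CategoryTheory.ShortComplex.ShortExact

variable {S : ShortComplex C} (hS : S.ShortExact)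
include hS

theorem subsingleton_ext_X₃_of_injective [Injective S.X₂] {X : C} {n : ℕ}
    (h : Subsingleton (Ext.{w} X S.X₁ (n + 2))) : Subsingleton (Ext.{w} X S.X₃ (n + 1)) := by
  refine subsingleton_of_forall_eq 0 fun x => ?_
  obtain ⟨y, rfl⟩ := Ext.covariant_sequence_exact₃ X hS x rfl (Subsingleton.elim _ _)
  rw [y.eq_zero_of_injective, Ext.zero_comp]

theorem subsingleton_ext_X₃_of_projective [Projective S.X₂] {Y : C} {n : ℕ}
    (h : Subsingleton (Ext.{w} S.X₁ Y n)) : Subsingleton (Ext.{w} S.X₃ Y (n + 1)) := by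
  refine subsingleton_of_forall_eq 0 fun x => ?_
  obtain ⟨y, rfl⟩ := Ext.contravariant_sequence_exact₃ hS Y x (Ext.eq_zero_of_projective _)
    (add_comm 1 n)
  rw [Subsingleton.elim y 0, Ext.comp_zero]

/-- If every map from the left term to `Y` extends to the middle term, and the latter is projective,
then the right term has no first extensions by `Y`. -/
theorem subsingleton_ext_one_X₃ [Projective S.X₂] {Y : C}
    (h : ∀ f : S.X₁ ⟶ Y, ∃ g : S.X₂ ⟶ Y, S.f ≫ g = f) : Subsingleton (Ext.{w} S.X₃ Y 1) := by
  refine subsingleton_of_forall_eq 0 fun x => ?_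
  obtain ⟨y, rfl⟩ := Ext.contravariant_sequence_exact₃ hS Y x (Ext.eq_zero_of_projective _)
    (add_zero 1)
  obtain ⟨f, rfl⟩ := (Ext.mk₀_bijective _ _).2 y
  obtain ⟨g, rfl⟩ := h f
  rw [← Ext.mk₀_comp_mk₀, extClass_comp_assoc]

end CategoryTheory.ShortComplex.ShortExact

end Ext

/-! ### Cosyzygies -/

namespace CategoryTheory.InjectiveResolution

open Abelian

variable {R : Type u} [Ring R] {M : ModuleCat.{u} R} (I : InjectiveResolution M)

/-- The `a`-th cosyzygy of `M` with respect to an injective resolution: the kernel of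
`Iᵃ → Iᵃ⁺¹`, which is isomorphic to `M` for `a = 0` and is the image of `Iᵃ⁻¹ → Iᵃ` for `a > 0`. -/
abbrev cosyzygy (a : ℕ) : ModuleCat.{u} R :=
  ModuleCat.of R (LinearMap.ker (I.cocomplex.d a (a + 1)).hom)

theorem exact_d (a : ℕ) : Function.Exact (I.cocomplex.d a (a + 1)).hom
    (I.cocomplex.d (a + 1) (a + 2)).hom :=
  (ShortComplex.ShortExact.moduleCat_exact_iff_function_exact _).1 (I.exact_succ a)

/-- The map `Iᵃ → Iᵃ⁺¹`, viewed as a surjection onto the next cosyzygy. -/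
def toCosyzygy (a : ℕ) : I.cocomplex.X a →ₗ[R] I.cosyzygy (a + 1) :=
  LinearMap.codRestrict _ (I.cocomplex.d a (a + 1)).hom fun x => (I.exact_d a).apply_apply_eq_zero x

theorem toCosyzygy_surjective (a : ℕ) : Function.Surjective (I.toCosyzygy a) := by
  rintro ⟨y, hy⟩
  obtain ⟨x, rfl⟩ := (I.exact_d a y).1 hy
  exact ⟨x, rfl⟩

theorem ker_toCosyzygy (a : ℕ) :
    LinearMap.ker (I.toCosyzygy a) = LinearMap.ker (I.cocomplex.d a (a + 1)).hom :=
  LinearMap.ker_codRestrict _ _ _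

/-- The short exact sequence of a cosyzygy, its injective term and the next cosyzygy. -/
abbrev cosyzygyShortComplex (a : ℕ) : ShortComplex (ModuleCat.{u} R) :=
  ModuleCat.shortComplexOfCompEqZero (LinearMap.ker (I.cocomplex.d a (a + 1)).hom).subtype
    (I.toCosyzygy a) (by
      ext ⟨x, hx⟩
      exact hx)

theorem shortExact_cosyzygyShortComplex (a : ℕ) : (I.cosyzygyShortComplex a).ShortExact := by
  refine ModuleCat.shortComplex_shortExact _ ?_ (Submodule.injective_subtype _)
    (I.toCosyzygy_surjective a)
  change Function.Exact (LinearMap.ker (I.cocomplex.d a (a + 1)).hom).subtype (I.toCosyzygy a)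
  rw [LinearMap.exact_iff, Submodule.range_subtype, ker_toCosyzygy]

theorem nonempty_cosyzygy_zero_equiv : Nonempty (I.cosyzygy 0 ≃ₗ[R] M) := by
  have hex : Function.Exact (I.ι.f 0).hom (I.cocomplex.d 0 1).hom :=
    (ShortComplex.ShortExact.moduleCat_exact_iff_function_exact _).1 I.exact₀
  have hinj : Function.Injective (I.ι.f 0).hom := (ModuleCat.mono_iff_injective _).1 inferInstance
  exact ⟨(LinearEquiv.ofEq _ _ (LinearMap.exact_iff.1 hex)) ≪≫ₗ
    (LinearEquiv.ofInjective _ hinj).symm⟩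

instance (a : ℕ) : Injective (I.cosyzygyShortComplex a).X₂ := I.injective a

/-- By minimality each term is an essential extension of a finitely generated cosyzygy. -/
theorem finite_cosyzygy (K : Type*) [Field K] [Algebra K R] [FiniteDimensional K R]
    [Module.Finite R M] (hI : IsMinimalInjectiveResolution I) (a : ℕ) :
    Module.Finite R (I.cosyzygy a) ∧ Module.Finite R (I.cocomplex.X a) := by
  suffices h : Module.Finite R (I.cosyzygy a) from
    ⟨h, Module.Finite.of_essential K _ (hI a)⟩
  induction a with
  | zero => exact Module.Finite.equiv I.nonempty_cosyzygy_zero_equiv.some.symm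
  | succ a ih =>
    have : Module.Finite R (I.cocomplex.X a) := Module.Finite.of_essential K _ (hI a)
    exact Module.Finite.of_surjective _ (I.toCosyzygy_surjective a)

/-- Dimension shifting in the second variable, along the injective terms. -/
theorem subsingleton_ext_cosyzygy_of_self {X : ModuleCat.{u} R} (b : ℕ) {i : ℕ}
    (h : Subsingleton (Ext.{u} X M (i + 1 + b))) :
    Subsingleton (Ext.{u} X (I.cosyzygy b) (i + 1)) := by
  induction b generalizing i with
  | zero =>
    let e := I.nonempty_cosyzygy_zero_equiv.some.toModuleIso
    exact Ext.subsingleton_of_sum_eq_id_right (ι := Unit) (fun _ => e.hom) (fun _ => e.inv)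
      (by simp) fun _ => h
  | succ b ih =>
    refine (I.shortExact_cosyzygyShortComplex b).subsingleton_ext_X₃_of_injective ?_
    refine ih (i := i + 1) ?_
    rwa [show i + 1 + 1 + b = i + 1 + (b + 1) by omega]

variable {n : ℕ} (hproj : ∀ i < n, Projective (I.cocomplex.X i))
include hproj

/-- Dimension shifting in the first variable, along the projective terms. -/
theorem subsingleton_ext_cosyzygy_add {Y : ModuleCat.{u} R} {c i : ℕ} (t : ℕ) (hct : c + t ≤ n)
    (h : Subsingleton (Ext.{u} (I.cosyzygy c) Y i)) :
    Subsingleton (Ext.{u} (I.cosyzygy (c + t)) Y (i + t)) := by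
  induction t with
  | zero => exact h
  | succ t ih =>
    have : Projective (I.cosyzygyShortComplex (c + t)).X₂ := hproj (c + t) (by omega)
    exact (I.shortExact_cosyzygyShortComplex (c + t)).subsingleton_ext_X₃_of_projective
      (ih (by omega))

/-- Let `M` be projective, with `I⁰, …, Iⁿ⁻¹` projective and all maps from the second and later
cosyzygies to `M` extendable. Dimension shifting in both variables then reduces the vanishing of
`Extⁱ` between cosyzygies to that of `Extʲ(M, M)` with `j ≥ 1`, or to the extension property. -/
theorem subsingleton_ext_cosyzygy [Projective M]
    (hext : ∀ c, 2 ≤ c → c < n → ∀ f : I.cosyzygy c ⟶ M,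
      ∃ g : I.cocomplex.X c ⟶ M, (I.cosyzygyShortComplex c).f ≫ g = f)
    {a b i : ℕ} (ha : a ≤ n) (hi : 1 ≤ i) (h : a < i + b ∨ i + b + 2 ≤ a) :
    Subsingleton (Ext.{u} (I.cosyzygy a) (I.cosyzygy b) i) := by
  obtain ⟨i, rfl⟩ := Nat.exists_eq_add_of_le' hi
  refine I.subsingleton_ext_cosyzygy_of_self b ?_
  rcases h with h | h
  · have : Projective (I.cosyzygy 0) :=
      Projective.of_iso I.nonempty_cosyzygy_zero_equiv.some.toModuleIso.symm inferInstance
    obtain ⟨m, hm⟩ : ∃ m, i + 1 + b = m + 1 + a := ⟨i + b - a, by omega⟩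
    have := I.subsingleton_ext_cosyzygy_add hproj (c := 0) (Y := M) a (by omega)
      (Ext.subsingleton_of_projective _ _ m)
    rwa [zero_add, ← hm] at this
  · obtain ⟨c, rfl⟩ : ∃ c, a = c + 1 + (i + b) := ⟨a - 1 - (i + b), by omega⟩
    have : Projective (I.cosyzygyShortComplex c).X₂ := hproj c (by omega)
    have := I.subsingleton_ext_cosyzygy_add hproj (i + b) (by omega)
      ((I.shortExact_cosyzygyShortComplex c).subsingleton_ext_one_X₃
        (hext c (by omega) (by omega)))
    rwa [show i + 1 + b = 1 + (i + b) by omega]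

theorem hasProjectiveDimensionLT_cosyzygy [Projective M] {a : ℕ} (ha : a ≤ n) :
    HasProjectiveDimensionLT (I.cosyzygy a) (a + 1) := by
  induction a with
  | zero =>
    have : Projective (I.cosyzygy 0) :=
      Projective.of_iso I.nonempty_cosyzygy_zero_equiv.some.toModuleIso.symm inferInstance
    infer_instance
  | succ a ih =>
    exact ((I.shortExact_cosyzygyShortComplex a).hasProjectiveDimensionLT_X₃_iff a
      (hproj a (by omega))).2 (ih (by omega))

/-- The projective dimension of the `a`-th cosyzygy drops below `a` only if the sequence which
starts with `M → I⁰` splits. -/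
theorem not_hasProjectiveDimensionLT_cosyzygy (hM : ¬ Injective M) {a : ℕ} (ha0 : 1 ≤ a)
    (ha : a ≤ n) : ¬ HasProjectiveDimensionLT (I.cosyzygy a) a := by
  induction a, ha0 using Nat.le_induction with
  | base =>
    intro h
    have : Projective (I.cosyzygyShortComplex 0).X₃ :=
      projective_iff_hasProjectiveDimensionLT_one.2 h
    let s := (I.shortExact_cosyzygyShortComplex 0).splittingOfProjective
    have : Injective (I.cosyzygy 0) :=
      Retract.injective (Y := I.cocomplex.X 0) ⟨(I.cosyzygyShortComplex 0).f, s.r, s.f_r⟩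
    exact hM (Injective.of_iso I.nonempty_cosyzygy_zero_equiv.some.toModuleIso this)
  | succ a ha0 ih =>
    intro h
    obtain ⟨a, rfl⟩ := Nat.exists_eq_add_of_le' ha0
    exact ih (by omega) (((I.shortExact_cosyzygyShortComplex (a + 1)).hasProjectiveDimensionLT_X₃_iff
      a (hproj (a + 1) (by omega))).1 h)

end CategoryTheory.InjectiveResolution

/-! ### Rigid modules built from cosyzygies -/

section Rigid

variable {R : Type u} [Ring R]

theorem IsDirectSummandOf.of_linearEquiv {X M N : ModuleCat.{u} R} (h : IsDirectSummandOf X M)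
    (e : M ≃ₗ[R] N) : IsDirectSummandOf X N := by
  obtain ⟨Y, ⟨f⟩⟩ := h
  exact ⟨Y, ⟨e.symm ≪≫ₗ f⟩⟩

theorem isDirectSummandOf_pi {J : Type} [DecidableEq J] (W : J → ModuleCat.{u} R) (j : J) :
    IsDirectSummandOf (W j) (ModuleCat.of R (∀ j, W j)) :=
  .of_retraction (LinearMap.single R (fun j => W j) j) (LinearMap.proj j) (by ext; simp)

/-- The identity of a module in the additive closure of `∏ j, W j` is a sum of maps which factor
through the `W j`. -/
theorem IsInAdd.exists_sum_eq_id {J : Type} [Fintype J] [DecidableEq J] {W : J → ModuleCat.{u} R}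
    {X : ModuleCat.{u} R} (h : IsInAdd X (ModuleCat.of R (∀ j, W j))) :
    ∃ (n : ℕ) (p : ∀ i : Fin n × J, X ⟶ W i.2) (q : ∀ i : Fin n × J, W i.2 ⟶ X),
      ∑ i, p i ≫ q i = 𝟙 X := by
  obtain ⟨n, -, h⟩ := h
  obtain ⟨f, g, hgf⟩ := h.exists_retraction
  refine ⟨n, fun i => ModuleCat.ofHom (LinearMap.proj i.2 ∘ₗ LinearMap.proj i.1 ∘ₗ f),
    fun i => ModuleCat.ofHom (g ∘ₗ LinearMap.single R (fun _ => ∀ j, W j) i.1 ∘ₗ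
      LinearMap.single R (fun j => W j) i.2), ?_⟩
  ext x
  have hx : ∑ i : Fin n × J, (LinearMap.single R (fun _ : Fin n => ∀ j, W j) i.1)
      (LinearMap.single R (fun j => W j) i.2 (f x i.1 i.2)) = f x := by
    rw [Fintype.sum_prod_type]
    simp only [← map_sum]
    simp only [LinearMap.coe_single, Finset.univ_sum_single]
  rw [ModuleCat.hom_sum, LinearMap.sum_apply]
  calc _ = g (f x) := by
        rw [← hx, map_sum]
        rfl
    _ = x := LinearMap.congr_fun hgf x

theorem isRigidModule_pi {J : Type} [Fintype J] [DecidableEq J] {W : J → ModuleCat.{u} R} {k : ℕ}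
    (h : ∀ a b : J, ∀ i : ℕ, 1 ≤ i → i ≤ k → Subsingleton (Abelian.Ext.{u} (W a) (W b) i)) :
    IsRigidModule k (ModuleCat.of R (∀ j, W j)) := by
  intro X Y hX hY i hi hik
  obtain ⟨m, p, q, hpq⟩ := hX.exists_sum_eq_id
  obtain ⟨m', p', q', hpq'⟩ := hY.exists_sum_eq_id
  exact Abelian.Ext.subsingleton_of_sum_eq_id_left p q hpq fun a =>
    Abelian.Ext.subsingleton_of_sum_eq_id_right p' q' hpq' fun b => h a.2 b.2 i hi hik

/-- A summand `N` of `M` and further indecomposable summands `Y j`, pairwise nonisomorphic and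
not isomorphic to summands of `N`, bound the size of `M` from below. -/
theorem moduleSize_add_le {M N : ModuleCat.{u} R} (hN : IsDirectSummandOf N M) {t : ℕ}
    (Y : Fin t → ModuleCat.{u} R) (hY : ∀ j, Indecomposable (Y j))
    (hYM : ∀ j, IsDirectSummandOf (Y j) M)
    (hYY : ∀ i j, i < j → IsEmpty (Y i ≃ₗ[R] Y j))
    (hYN : ∀ j X, IsDirectSummandOf X N → IsEmpty (X ≃ₗ[R] Y j)) :
    moduleSize N + t ≤ moduleSize M := by
  let c : ModuleCat.{u} R → Quotient (isIsomorphicSetoid (ModuleCat.{u} R)) :=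
    fun X => Quotient.mk _ X
  have hinj : Function.Injective (c ∘ Y) := by
    intro i j hij
    obtain ⟨e⟩ := Quotient.mk_isIsomorphic_eq_iff.1 hij
    rcases lt_trichotomy i j with h | h | h
    exacts [((hYY i j h).false e).elim, h, ((hYY j i h).false e.symm).elim]
  have hdisj : Disjoint (c '' {X | Indecomposable X ∧ IsDirectSummandOf X N})
      (Set.range (c ∘ Y)) := by
    rw [Set.disjoint_left]
    rintro _ ⟨X, ⟨-, hX⟩, rfl⟩ ⟨j, hj⟩
    obtain ⟨e⟩ := Quotient.mk_isIsomorphic_eq_iff.1 hj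
    exact (hYN j X hX).false e.symm
  have hrange : (Set.range (c ∘ Y)).encard = t := by
    rw [← Set.image_univ, hinj.encard_image, Set.encard_univ]
    simp
  change (c '' {X | Indecomposable X ∧ IsDirectSummandOf X N}).encard + t ≤
    (c '' {X | Indecomposable X ∧ IsDirectSummandOf X M}).encard
  rw [← hrange, ← Set.encard_union_eq hdisj]
  refine Set.encard_le_encard (Set.union_subset (Set.image_mono ?_) ?_)
  · exact fun X hX => ⟨hX.1, hX.2.trans hN⟩
  · rintro _ ⟨j, rfl⟩
    exact ⟨Y j, ⟨hY j, hYM j⟩, rfl⟩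

theorem IsDirectSummandOf.hasProjectiveDimensionLT {X M : ModuleCat.{u} R}
    (h : IsDirectSummandOf X M) (n : ℕ) [HasProjectiveDimensionLT M n] :
    HasProjectiveDimensionLT X n := by
  obtain ⟨i, p, hip⟩ := h.exists_retraction
  exact Retract.hasProjectiveDimensionLT (Y := M)
    ⟨ModuleCat.ofHom i, ModuleCat.ofHom p, by rw [← ModuleCat.ofHom_comp, hip]; rfl⟩ n

/-- Projective dimension at least `n` is attained on an indecomposable direct summand. -/
theorem exists_indecomposable_not_hasProjectiveDimensionLT {M : ModuleCat.{u} R} [IsNoetherian R M]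
    [IsArtinian R M] {n : ℕ} (h : ¬ HasProjectiveDimensionLT M n) :
    ∃ Y : ModuleCat.{u} R, Indecomposable Y ∧ IsDirectSummandOf Y M ∧
      ¬ HasProjectiveDimensionLT Y n := by
  by_contra! hY
  refine h (indecomposable_induction (P := fun X => HasProjectiveDimensionLT X n) ?_ ?_ M hY)
  · intro X hX
    have := (ModuleCat.isZero_of_subsingleton X).hasProjectiveDimensionLT_zero
    exact hasProjectiveDimensionLT_of_ge X 0 n n.zero_le
  · intro M X Y e hX hY
    exact hasProjectiveDimensionLT_of_iso (e.toModuleIso ≪≫ (ModuleCat.biprodIsoProd X Y).symm).symm n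

end Rigid

/-! ### Gendo-symmetric algebras -/

section Gendo

open MulOpposite

variable {K : Type*} [Field K] {A : Type u} [Ring A] [Algebra K A] [FiniteDimensional K A]

/-- The regular right module is the regular left module over the opposite algebra. -/
def rightRegularEquiv (A : Type u) [Ring A] : Aᵐᵒᵖ ≃ₗ[Aᵐᵒᵖ] A where
  toFun := unop
  invFun := op
  map_add' _ _ := rfl
  map_smul' _ _ := rfl
  left_inv _ := rfl
  right_inv _ := rfl

/-- The composite of `f : C c → A` with `Iᶜ⁻¹ → C c` vanishes on the image of `Iᶜ⁻²`, so it factors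
through `Iᶜ⁻¹ → Iᶜ` by the exactness of `Hom_A(-, A)`, and the factorization extends `f`. -/
theorem IsGendoSymmetric.exists_extension (h : IsGendoSymmetric K A)
    {I : InjectiveResolution (ModuleCat.of Aᵐᵒᵖ A)} (hI : IsMinimalInjectiveResolution I) {n : ℕ}
    (hproj : ∀ i < n, Projective (I.cocomplex.X i)) (c : ℕ) (hc : 2 ≤ c) (hcn : c < n)
    (f : I.cosyzygy c ⟶ ModuleCat.of Aᵐᵒᵖ A) :
    ∃ g : I.cocomplex.X c ⟶ ModuleCat.of Aᵐᵒᵖ A, (I.cosyzygyShortComplex c).f ≫ g = f := by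
  obtain ⟨-, e, he, ⟨hfaith, -⟩, -, hdual⟩ := h
  have hfaith' : FaithfulSMul Aᵐᵒᵖ (rightIdealOf e) := hfaith
  have hA : Module.Finite Aᵐᵒᵖ A := Module.Finite.of_restrictScalars_finite K Aᵐᵒᵖ A
  have hB : ∀ i < n, Nonempty (CornerBasis e (I.cocomplex.X i)) := by
    intro i hi
    have := hproj i hi
    have : Module.Projective Aᵐᵒᵖ (I.cocomplex.X i) := (IsProjective.iff_projective _).2 this
    have : Module.Injective Aᵐᵒᵖ (I.cocomplex.X i) :=
      Module.injective_module_of_injective_object _ _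
    have := (I.finite_cosyzygy K hI i).2
    exact nonempty_cornerBasis K he _
  obtain ⟨a, rfl⟩ := Nat.exists_eq_add_of_le' hc
  obtain ⟨g, hg⟩ := hdual.exists_comp_eq_of_exact he (hB a (by omega)).some
    (hB (a + 1) (by omega)).some (hB (a + 2) hcn).some (I.exact_d a)
    (f.hom ∘ₗ I.toCosyzygy (a + 1)) (by
      ext x
      have : I.toCosyzygy (a + 1) ((I.cocomplex.d a (a + 1)).hom x) = 0 :=
        Subtype.ext ((I.exact_d a).apply_apply_eq_zero x)
      simp [this])
  refine ⟨ModuleCat.ofHom g, ?_⟩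
  ext y
  obtain ⟨x, rfl⟩ := I.toCosyzygy_surjective (a + 1) y
  exact LinearMap.congr_fun hg x

/-- The module `∏ j ≤ t, C (j (k + 2))` is `k`-rigid. Its summand `C 0 = A` contributes at least as
many indecomposable summands as there are simple modules, and every further factor contributes one
of projective dimension exactly `j (k + 2)`. -/
theorem IsGendoSymmetric.numSimples_add_le_rigidSize (h : IsGendoSymmetric K A)
    (hself : ¬ IsSelfinjectiveAlgebra A) {I : InjectiveResolution (ModuleCat.of Aᵐᵒᵖ A)}
    (hI : IsMinimalInjectiveResolution I) {n k t : ℕ}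
    (hproj : ∀ i < n, Projective (I.cocomplex.X i)) (ht : t * (k + 2) ≤ n) :
    numSimples A + t ≤ rigidSize k A := by
  have hA : Module.Finite Aᵐᵒᵖ A := Module.Finite.of_restrictScalars_finite K Aᵐᵒᵖ A
  have : IsNoetherianRing Aᵐᵒᵖ := isNoetherian_of_tower K inferInstance
  have : IsArtinianRing Aᵐᵒᵖ := isArtinian_of_tower K inferInstance
  have hAproj : Projective (ModuleCat.of Aᵐᵒᵖ A) :=
    (IsProjective.iff_projective _).1 (Module.Projective.of_equiv (rightRegularEquiv A))
  have hAinj : ¬ Injective (ModuleCat.of Aᵐᵒᵖ A) := fun _ =>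
    hself (Module.injective_module_of_injective_object Aᵐᵒᵖ A)
  let W : Fin (t + 1) → ModuleCat.{u} Aᵐᵒᵖ := fun j => I.cosyzygy (j * (k + 2))
  have hle : ∀ j : Fin (t + 1), (j : ℕ) * (k + 2) ≤ n := fun j =>
    (Nat.mul_le_mul_right _ (Nat.lt_succ_iff.1 j.2)).trans ht
  have hfin : ∀ j, Module.Finite Aᵐᵒᵖ (W j) := fun j => (I.finite_cosyzygy K hI _).1
  have hrigid : IsRigidModule k (ModuleCat.of Aᵐᵒᵖ (∀ j, W j)) := by
    refine isRigidModule_pi fun a b i hi hik => ?_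
    refine I.subsingleton_ext_cosyzygy hproj (h.exists_extension hI hproj) (hle a) hi ?_
    rcases le_or_gt (a : ℕ) b with hab | hab
    · have := Nat.mul_le_mul_right (k + 2) hab
      omega
    · have := Nat.mul_le_mul_right (k + 2) (Nat.succ_le_of_lt hab)
      rw [Nat.succ_mul] at this
      omega
  have hY : ∀ j : Fin t, ∃ Y : ModuleCat.{u} Aᵐᵒᵖ, Indecomposable Y ∧
      IsDirectSummandOf Y (W j.succ) ∧
        ¬ HasProjectiveDimensionLT Y ((j.succ : Fin (t + 1)) * (k + 2)) := by
    intro j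
    have := hfin j.succ
    refine exists_indecomposable_not_hasProjectiveDimensionLT ?_
    exact I.not_hasProjectiveDimensionLT_cosyzygy hproj hAinj
      (Nat.mul_pos j.succ_pos (by omega)) (hle j.succ)
  choose Y hY hYW hYn using hY
  have hYlt : ∀ j, HasProjectiveDimensionLT (Y j) ((j.succ : Fin (t + 1)) * (k + 2) + 1) := by
    intro j
    have := I.hasProjectiveDimensionLT_cosyzygy hproj (hle j.succ)
    exact (hYW j).hasProjectiveDimensionLT _
  have hsize : moduleSize (ModuleCat.of Aᵐᵒᵖ Aᵐᵒᵖ) + t ≤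
      moduleSize (ModuleCat.of Aᵐᵒᵖ (∀ j, W j)) := by
    refine moduleSize_add_le ?_ Y hY (fun j => (hYW j).trans (isDirectSummandOf_pi W _)) ?_ ?_
    · refine IsDirectSummandOf.trans (IsDirectSummandOf.of_linearEquiv (.refl _) ?_)
        (isDirectSummandOf_pi W 0)
      have hW : W 0 = I.cosyzygy 0 := congrArg I.cosyzygy (by simp)
      rw [hW]
      exact rightRegularEquiv A ≪≫ₗ I.nonempty_cosyzygy_zero_equiv.some.symm
    · refine fun i j hij => ⟨fun e => hYn j ?_⟩
      have := hYlt i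
      have := hasProjectiveDimensionLT_of_iso e.toModuleIso ((i.succ : Fin (t + 1)) * (k + 2) + 1)
      have h1 := Nat.mul_le_mul_right (k + 2) (Nat.succ_le_of_lt (Fin.succ_lt_succ_iff.2 hij))
      rw [Nat.succ_mul] at h1
      exact hasProjectiveDimensionLT_of_ge (Y j) ((i.succ : Fin (t + 1)) * (k + 2) + 1) _
        (by omega)
    · refine fun j X hX => ⟨fun e => hYn j ?_⟩
      have := hX.projective_of_self
      have : Projective X := (IsProjective.iff_projective _).1 this
      have := hasProjectiveDimensionLT_of_iso e.toModuleIso 1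
      exact hasProjectiveDimensionLT_of_ge _ 1 _ (Nat.mul_pos j.succ_pos (by omega))
  calc numSimples A + t ≤ moduleSize (ModuleCat.of Aᵐᵒᵖ Aᵐᵒᵖ) + t := by
        gcongr
        exact countUpToIso_isSimpleModule_le_moduleSize Aᵐᵒᵖ
    _ ≤ moduleSize (ModuleCat.of Aᵐᵒᵖ (∀ j, W j)) := hsize
    _ ≤ rigidSize k A := le_iSup (fun M : {M : ModuleCat.{u} Aᵐᵒᵖ //
        Module.Finite Aᵐᵒᵖ M ∧ IsRigidModule k M} => moduleSize (M : ModuleCat.{u} Aᵐᵒᵖ))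
        ⟨ModuleCat.of Aᵐᵒᵖ (∀ j, W j), inferInstanceAs (Module.Finite Aᵐᵒᵖ (∀ j, W j)), hrigid⟩

end Gendo

theorem mainTheorem1 (K : Type*) [Field K] (A : Type*) [Ring A] [Algebra K A]
    [FiniteDimensional K A] (hgendo : IsGendoSymmetric K A)
    (hself : ¬ IsSelfinjectiveAlgebra A) (k : ℕ) (hk : 1 ≤ k) :
    (((rigidSize k A : ENNReal) : EReal) + 2 - ((numSimples A : ENNReal) : EReal)) *
        ((k : EReal) + 2) - 1 ≥ ((algDomDim A : ENNReal) : EReal) := by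
  have : IsNoetherianRing Aᵐᵒᵖ := isNoetherian_of_tower K inferInstance
  have : IsArtinianRing Aᵐᵒᵖ := isArtinian_of_tower K inferInstance
  obtain ⟨w, hw⟩ := ENat.ne_top_iff_exists.1
    (countUpToIso_isSimpleModule_ne_top Aᵐᵒᵖ : numSimples A ≠ ⊤)
  change _ = numSimples A at hw
  have hcast : ∀ m : ℕ, (((m : ℕ∞) : ENNReal) : EReal) = ((m : ℝ) : EReal) := by
    intro m
    rw [ENat.toENNReal_coe, ← ENNReal.ofReal_natCast, EReal.coe_ennreal_ofReal,
      max_eq_left m.cast_nonneg]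
  rw [← hw, hcast]
  by_cases ho : rigidSize k A = ⊤
  · rw [ho]
    have hpos : (0 : EReal) < (k : EReal) + 2 := by positivity
    -- The number of simple modules is finite, so the difference is not the junk value `⊤ - ⊤ = ⊥`.
    have h1 : (((⊤ : ℕ∞) : ENNReal) : EReal) + 2 - ((w : ℝ) : EReal) = ⊤ := by
      rw [ENat.toENNReal_top, EReal.coe_ennreal_top]
      rfl
    rw [h1, EReal.top_mul_of_pos hpos]
    exact le_top
  obtain ⟨o, ho⟩ := ENat.ne_top_iff_exists.1 ho
  have hle : ∀ n t : ℕ, (∃ I : InjectiveResolution (ModuleCat.of Aᵐᵒᵖ A),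
      IsMinimalInjectiveResolution I ∧ ∀ i < n, Projective (I.cocomplex.X i)) →
      t * (k + 2) ≤ n → w + t ≤ o := by
    rintro n t ⟨I, hI, hproj⟩ ht
    have := hgendo.numSimples_add_le_rigidSize hself hI hproj ht
    rw [← hw, ← ho] at this
    exact_mod_cast this
  have hwo : w ≤ o := by
    -- Dominant dimension at least two provides a minimal injective resolution to use with `t = 0`.
    obtain ⟨n, hn⟩ : Nonempty {n : ℕ // ∃ I : InjectiveResolution (ModuleCat.of Aᵐᵒᵖ A),
        IsMinimalInjectiveResolution I ∧ ∀ i < n, Projective (I.cocomplex.X i)} := by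
      by_contra hne
      rw [not_nonempty_iff] at hne
      have h2 := hgendo.1
      rw [algDomDim, domDim, iSup_of_empty] at h2
      simp at h2
    simpa using hle n 0 hn (by simp)
  have hdom : algDomDim A ≤ (((o - w + 2) * (k + 2) - 1 : ℕ) : ℕ∞) := by
    refine iSup_le fun ⟨n, hn⟩ => ?_
    have h1 := hle n (n / (k + 2)) hn (Nat.div_mul_le_self _ _)
    have h2 := Nat.lt_div_mul_add (a := n) (b := k + 2) (by omega)
    have h3 : n / (k + 2) + 1 ≤ o - w + 2 := by omega
    have h4 := Nat.mul_le_mul_right (k + 2) h3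
    rw [Nat.succ_mul] at h4
    exact_mod_cast (by omega : n ≤ (o - w + 2) * (k + 2) - 1)
  rw [← ho]
  calc ((algDomDim A : ENNReal) : EReal)
      ≤ (((((o - w + 2) * (k + 2) - 1 : ℕ) : ℕ∞) : ENNReal) : EReal) := by
        exact EReal.coe_ennreal_le_coe_ennreal_iff.2 (ENat.toENNReal_le.2 hdom)
    _ = _ := by
        have hpos : 1 ≤ (o - w + 2) * (k + 2) := Nat.mul_pos (by omega) (by omega)
        rw [hcast, hcast, Nat.cast_sub hpos, Nat.cast_mul, Nat.cast_add, Nat.cast_sub hwo]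
        have h2 : (2 : EReal) = ((2 : ℝ) : EReal) := rfl
        have h1 : (1 : EReal) = ((1 : ℝ) : EReal) := rfl
        rw [h2, h1, ← EReal.coe_natCast (n := k), ← EReal.coe_add, ← EReal.coe_sub, ← EReal.coe_add,
          ← EReal.coe_mul, ← EReal.coe_sub]
        congr 1
        push_cast
        ring
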